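/- Let $k$ be an algebraically closed field of characteristic different from $2$. Let $D(\Lambda_2)$ be the Drinfel'd double of the $4$-dimensional Taft algebra, that is, the $k$-algebra generated by $x,X,g,G$ with relations \[ x^2=X^2=0,\quad g^2=G^2=1,\quad gG=Gg,\quad gx=-xg,\quad gX=-Xg,\quad Gx=-xG,\quad GX=-XG,\quad xX+Xx=1-gG, \] with the Hopf algebra structure in which $g$ and $G$ are grouplike, $\Delta(x)=1\otimes x+x\otimes g$, $\Delta(X)=1\otimes X+X\otimes G$, and the counit $\epsilon$ sends $g,G$ to $1$ and $x,X$ to $0$. Let $k$ also denote the trivial $D(\Lambda_2)$-module, and $k_-$ the one-dimensional module on which $g$ and $G$ act as $-1$ (and $x$, $X$ as $0$). For $(\alpha,\beta)\in k^2\setminus\{(0,0)\}$ let $H_{\alpha\beta}$ be the subalgebra of $D(\Lambda_2)$ generated by $g$, $G$ and $\alpha x+\beta X$. For a subalgebra $H$ of a Hopf algebra $\Lambda$, let $k_H$ be the one-dimensional $H$-module given by the restriction of the counit, and $k_H\!\uparrow^{\Lambda}\,=\Lambda\otimes_H k_H$. For $n\ge 1$, an element $\xi\in\operatorname{Ext}^n_\Lambda(M,N)$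 is said to be of induced type if it is represented by an exact sequence of $\Lambda$-modules \[ 0\to N\to L_{n-1}\otimes(k_{H_{n-1}}\!\uparrow^{\Lambda})\to\cdots\to L_0\otimes(k_{H_0}\!\uparrow^{\Lambda})\to M\to 0 \] for some finite-dimensional $\Lambda$-modules $L_0,\dots,L_{n-1}$ and some proper subalgebras $H_0,\dots,H_{n-1}$ of $\Lambda$, where $\Lambda$ acts on $\otimes=\otimes_k$ through the comultiplication; the $H_i$ are said to be involved. Then for every $n\ge 1$, every non-zero element of each of $\operatorname{Ext}^n_{D(\Lambda_2)}(k,k)$, $\operatorname{Ext}^n_{D(\Lambda_2)}(k,k_-)$, $\operatorname{Ext}^n_{D(\Lambda_2)}(k_-,k)$ and $\operatorname{Ext}^n_{D(\Lambda_2)}(k_-,k_-)$ is of induced type, with all the subalgebras involved of the form $H_{\alpha\beta}$, $(\alpha,\beta)\neq(0,0)$. -/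

import Mathlib

open scoped TensorProduct
open CategoryTheory

universe u

noncomputable section

/-! ## Modules over a Hopf algebra -/

section HopfModules

variable {k A : Type u} [Field k] [Ring A]

/-- The one-dimensional module `k` on which the `k`-algebra `A` acts through the character `χ`. -/
@[nolint unusedArguments]
def CharMod [Algebra k A] (_χ : A →ₐ[k] k) : Type u := k

section
variable [Algebra k A] (χ : A →ₐ[k] k)

instance : AddCommGroup (CharMod χ) := inferInstanceAs (AddCommGroup k)
instance : Module k (CharMod χ) := inferInstanceAs (Module k k)
instance : Module A (CharMod χ) := Module.compHom k χ.toRingHom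

theorem CharMod.smul_def (a : A) (v : CharMod χ) : a • v = χ a • v := rfl

instance : IsScalarTower k A (CharMod χ) where
  smul_assoc c a v := by
    rw [CharMod.smul_def, CharMod.smul_def, map_smul, smul_assoc]

end

/-- The trivial module `k_H` of a subalgebra `H`: the counit restricted to `H`. -/
abbrev TrivialMod [HopfAlgebra k A] (H : Subalgebra k A) : Type u :=
  CharMod ((Bialgebra.counitAlgHom k A).comp H.val)

/-- The induced module `V↑ = A ⊗_H V` of an `H`-module `V`, as the quotient of `A ⊗_k V` by the
`A`-submodule generated by the elements `a h ⊗ v - a ⊗ h v`. -/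
def Induced [Algebra k A] (H : Subalgebra k A) (V : Type u) [AddCommGroup V] [Module k V]
    [Module H V] : Type u :=
  (A ⊗[k] V) ⧸ Submodule.span A
    {t : A ⊗[k] V | ∃ (a : A) (h : H) (v : V), t = (a * (h : A)) ⊗ₜ[k] v - a ⊗ₜ[k] (h • v)}

section
variable [Algebra k A] (H : Subalgebra k A) (V : Type u) [AddCommGroup V] [Module k V] [Module H V]

instance : AddCommGroup (Induced H V) := by unfold Induced; infer_instance
instance : Module A (Induced H V) := by unfold Induced; infer_instance
instance : Module k (Induced H V) := by unfold Induced; infer_instance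
instance : IsScalarTower k A (Induced H V) := by unfold Induced; infer_instance

end

/-- The tensor product `L ⊗_k V` of two `A`-modules, with `A` acting through the
comultiplication: `a (l ⊗ v) = ∑ a₁ l ⊗ a₂ v`. -/
@[nolint unusedArguments]
def DiagTensor (k A : Type u) [Field k] [Ring A] [HopfAlgebra k A]
    (L V : Type u) [AddCommGroup L] [Module k L] [Module A L] [IsScalarTower k A L]
    [AddCommGroup V] [Module k V] [Module A V] [IsScalarTower k A V] : Type u :=
  L ⊗[k] V

section
variable [HopfAlgebra k A]
    (L V : Type u) [AddCommGroup L] [Module k L] [Module A L] [IsScalarTower k A L]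
    [AddCommGroup V] [Module k V] [Module A V] [IsScalarTower k A V]

/-- The algebra map `A → A ⊗ A → End L ⊗ End V → End (L ⊗ V)`. -/
def diagAction : A →ₐ[k] Module.End k (L ⊗[k] V) :=
  ((Module.endTensorEndAlgHom (R := k) (S := k) (A := k) (M := L) (N := V)).comp
    (Algebra.TensorProduct.map (Algebra.lsmul k k L) (Algebra.lsmul k k V))).comp
    (Bialgebra.comulAlgHom k A)

instance : AddCommGroup (DiagTensor k A L V) := inferInstanceAs (AddCommGroup (L ⊗[k] V))
instance : Module k (DiagTensor k A L V) := inferInstanceAs (Module k (L ⊗[k] V))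
instance : Module A (DiagTensor k A L V) :=
  Module.compHom (L ⊗[k] V) (diagAction (k := k) (A := A) L V).toRingHom

end

/-! ## Exact sequences and the elements of `Ext` they represent -/

/-- An exact sequence `0 → N → E_{n-1} → ⋯ → E_0 → M → 0` of `A`-modules, `n ≥ 1`, given as the
splice of the short exact sequences into which it decomposes. -/
inductive ExactSeq (N : ModuleCat.{u} A) : ModuleCat.{u} A → ℕ → Type (u + 1)
  /-- A short exact sequence `0 → N → E → M → 0`. -/
  | single {M E : ModuleCat.{u} A} (i : N ⟶ E) (p : E ⟶ M) (w : i ≫ p = 0)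
      (h : (ShortComplex.mk i p w).ShortExact) : ExactSeq N M 1
  /-- The splice of `0 → K → E → M → 0` with an exact sequence
  `0 → N → E_{n-1} → ⋯ → E_0 → K → 0`. -/
  | splice {M E K : ModuleCat.{u} A} {n : ℕ} (i : K ⟶ E) (p : E ⟶ M) (w : i ≫ p = 0)
      (h : (ShortComplex.mk i p w).ShortExact) (T : ExactSeq N K n) : ExactSeq N M (n + 1)

/-- The element of `Ext^n(M, N)` represented by an exact sequence
`0 → N → E_{n-1} → ⋯ → E_0 → M → 0`: the Yoneda product of the classes of its short exact
sequences. -/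
def ExactSeq.extClass {N : ModuleCat.{u} A} :
    {M : ModuleCat.{u} A} → {n : ℕ} → ExactSeq N M n → Abelian.Ext.{u} M N n
  | _, _, .single _ _ _ h => h.extClass
  | _, _, .splice _ _ _ h T => h.extClass.comp T.extClass (Nat.add_comm _ _)

/-- All the middle terms `E_0, …, E_{n-1}` of the exact sequence satisfy `P`. -/
def ExactSeq.AllTerms (P : ModuleCat.{u} A → Prop) {N : ModuleCat.{u} A} :
    {M : ModuleCat.{u} A} → {n : ℕ} → ExactSeq N M n → Prop
  | _, _, .single (E := E) _ _ _ _ => P E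
  | _, _, .splice (E := E) _ _ _ _ T => P E ∧ T.AllTerms P

/-- `ξ ∈ Ext^n(M, N)` is of induced type, with all the subalgebras involved in `𝒜`: it is
represented by an exact sequence whose `i`-th middle term is `L_i ⊗ (k_{H_i}↑)` for a
finite-dimensional module `L_i` and a proper subalgebra `H_i` in `𝒜`. -/
def IsOfInducedType [HopfAlgebra k A] (𝒜 : Set (Subalgebra k A)) {M N : ModuleCat.{u} A} {n : ℕ}
    (ξ : Abelian.Ext.{u} M N n) : Prop :=
  ∃ T : ExactSeq N M n, T.extClass = ξ ∧ T.AllTerms fun E =>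
    ∃ H ∈ 𝒜, H ≠ ⊤ ∧
    ∃ (L : Type u) (_ : AddCommGroup L) (_ : Module k L) (_ : Module A L)
      (_ : IsScalarTower k A L), Module.Finite k L ∧
      Nonempty (E ≃ₗ[A] DiagTensor k A L (Induced H (TrivialMod H)))

end HopfModules

/-! ## The Drinfel'd double of the Taft algebra of dimension four -/

namespace Taft

/-- The generators of the Drinfel'd double. -/
inductive Gen
  | x | X | g | G

section Presentation

variable (k : Type u) [Field k]

/-- A generator, in the free algebra. -/
abbrev fr (a : Gen) : FreeAlgebra k Gen := FreeAlgebra.ι k a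

/-- The defining relations of the Drinfel'd double. -/
inductive Rel : FreeAlgebra k Gen → FreeAlgebra k Gen → Prop
  | xx : Rel (fr k .x * fr k .x) 0
  | XX : Rel (fr k .X * fr k .X) 0
  | gg : Rel (fr k .g * fr k .g) 1
  | GG : Rel (fr k .G * fr k .G) 1
  | gG : Rel (fr k .g * fr k .G) (fr k .G * fr k .g)
  | gx : Rel (fr k .g * fr k .x) (-(fr k .x * fr k .g))
  | gX : Rel (fr k .g * fr k .X) (-(fr k .X * fr k .g))
  | Gx : Rel (fr k .G * fr k .x) (-(fr k .x * fr k .G))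
  | GX : Rel (fr k .G * fr k .X) (-(fr k .X * fr k .G))
  | xX : Rel (fr k .x * fr k .X + fr k .X * fr k .x) (1 - fr k .g * fr k .G)

end Presentation

/-- The Drinfel'd double `D(Λ₂)` of the Taft algebra `Λ₂` over `k`, by generators and relations. -/
def Double (k : Type u) [Field k] : Type u := RingQuot (Rel k)

section Structure

variable (k : Type u) [Field k]

instance : Ring (Double k) := inferInstanceAs (Ring (RingQuot (Rel k)))
instance : Algebra k (Double k) := inferInstanceAs (Algebra k (RingQuot (Rel k)))

/-- The image of a generator in the Drinfel'd double. -/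
def gen (a : Gen) : Double k := RingQuot.mkAlgHom k (Rel k) (FreeAlgebra.ι k a)

variable {k}

/-- The elements `v a` of `B` satisfy the defining relations. -/
structure SatisfiesRel {B : Type*} [Ring B] (v : Gen → B) : Prop where
  xx : v .x * v .x = 0
  XX : v .X * v .X = 0
  gg : v .g * v .g = 1
  GG : v .G * v .G = 1
  gG : v .g * v .G = v .G * v .g
  gx : v .g * v .x = -(v .x * v .g)
  gX : v .g * v .X = -(v .X * v .g)
  Gx : v .G * v .x = -(v .x * v .G)
  GX : v .G * v .X = -(v .X * v .G)
  xX : v .x * v .X + v .X * v .x = 1 - v .g * v .G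

theorem gen_satisfiesRel : SatisfiesRel (gen k) := by
  constructor <;> unfold gen
  · simpa using! RingQuot.mkAlgHom_rel k (Rel.xx (k := k))
  · simpa using! RingQuot.mkAlgHom_rel k (Rel.XX (k := k))
  · simpa using! RingQuot.mkAlgHom_rel k (Rel.gg (k := k))
  · simpa using! RingQuot.mkAlgHom_rel k (Rel.GG (k := k))
  · simpa using! RingQuot.mkAlgHom_rel k (Rel.gG (k := k))
  · simpa using! RingQuot.mkAlgHom_rel k (Rel.gx (k := k))
  · simpa using! RingQuot.mkAlgHom_rel k (Rel.gX (k := k))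
  · simpa using! RingQuot.mkAlgHom_rel k (Rel.Gx (k := k))
  · simpa using! RingQuot.mkAlgHom_rel k (Rel.GX (k := k))
  · simpa using! RingQuot.mkAlgHom_rel k (Rel.xX (k := k))

/-- The algebra map out of the Drinfel'd double given by elements satisfying the relations. -/
def lift {B : Type*} [Ring B] [Algebra k B] (v : Gen → B) (hv : SatisfiesRel v) :
    Double k →ₐ[k] B :=
  RingQuot.liftAlgHom k ⟨FreeAlgebra.lift k v, by
    intro a b h
    cases h
    · simpa using hv.xx
    · simpa using hv.XX
    · simpa using hv.gg
    · simpa using hv.GG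
    · simpa using hv.gG
    · simpa using hv.gx
    · simpa using hv.gX
    · simpa using hv.Gx
    · simpa using hv.GX
    · simpa using hv.xX⟩

@[simp]
theorem lift_gen {B : Type*} [Ring B] [Algebra k B] (v : Gen → B) (hv : SatisfiesRel v)
    (a : Gen) : lift (k := k) v hv (gen k a) = v a := by
  unfold lift gen
  erw [RingQuot.liftAlgHom_mkAlgHom_apply]
  simp

theorem algHom_ext {B : Type*} [Ring B] [Algebra k B] {f f' : Double k →ₐ[k] B}
    (h : ∀ a, f (gen k a) = f' (gen k a)) : f = f' := by
  apply RingQuot.ringQuot_ext' k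
  apply FreeAlgebra.hom_ext
  funext a
  exact h a

/-- The values of the comultiplication on the generators. -/
def comulGen : Gen → Double k ⊗[k] Double k
  | .x => 1 ⊗ₜ gen k .x + gen k .x ⊗ₜ gen k .g
  | .X => 1 ⊗ₜ gen k .X + gen k .X ⊗ₜ gen k .G
  | .g => gen k .g ⊗ₜ gen k .g
  | .G => gen k .G ⊗ₜ gen k .G

/-- The values of the counit on the generators. -/
def counitGen : Gen → k
  | .x => 0
  | .X => 0
  | .g => 1
  | .G => 1

/-- The values of the character of the module `k_-` on the generators. -/
def minusGen : Gen → k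
  | .x => 0
  | .X => 0
  | .g => -1
  | .G => -1

/-- The values of the antipode on the generators. -/
def antipodeGen : Gen → (Double k)ᵐᵒᵖ
  | .x => MulOpposite.op (-(gen k .x * gen k .g))
  | .X => MulOpposite.op (-(gen k .X * gen k .G))
  | .g => MulOpposite.op (gen k .g)
  | .G => MulOpposite.op (gen k .G)

theorem counitGen_satisfiesRel : SatisfiesRel (counitGen (k := k)) := by
  constructor <;> simp [counitGen]

theorem minusGen_satisfiesRel : SatisfiesRel (minusGen (k := k)) := by
  constructor <;> simp [minusGen]

theorem comulGen_satisfiesRel : SatisfiesRel (comulGen (k := k)) := by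
  have r := gen_satisfiesRel (k := k)
  constructor <;> simp only [comulGen, mul_add, add_mul, Algebra.TensorProduct.tmul_mul_tmul,
    one_mul, mul_one, r.xx, r.XX, r.gg, r.GG, r.gx, r.gX, r.Gx, r.GX,
    TensorProduct.tmul_zero, TensorProduct.zero_tmul, TensorProduct.tmul_neg,
    TensorProduct.neg_tmul, Algebra.TensorProduct.one_def, r.gG]
  · abel
  · abel
  · abel
  · abel
  · abel
  · abel
  · have h := r.xX
    have h1 : gen k .x * gen k .X = 1 - gen k .g * gen k .G - gen k .X * gen k .x := by
      rw [← h]; abel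
    rw [h1, r.gG]
    simp only [TensorProduct.tmul_sub, TensorProduct.sub_tmul]
    abel

/-- The comultiplication. -/
def comulHom : Double k →ₐ[k] Double k ⊗[k] Double k := lift comulGen comulGen_satisfiesRel

/-- The counit. -/
def counitHom : Double k →ₐ[k] k := lift counitGen counitGen_satisfiesRel

/-- The Drinfel'd double as a bialgebra: `g` and `G` are grouplike,
`Δ x = 1 ⊗ x + x ⊗ g`, `Δ X = 1 ⊗ X + X ⊗ G`, `ε g = ε G = 1` and `ε x = ε X = 0`. -/
instance : Bialgebra k (Double k) :=
  Bialgebra.ofAlgHom comulHom counitHom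
    (algHom_ext fun a => by
      cases a <;> simp [comulHom, comulGen, TensorProduct.tmul_add, TensorProduct.add_tmul,
        Algebra.TensorProduct.one_def, add_assoc])
    (algHom_ext fun a => by
      cases a <;> simp [comulHom, comulGen, counitHom, counitGen])
    (algHom_ext fun a => by
      cases a <;> simp [comulHom, comulGen, counitHom, counitGen])

theorem comul_apply (a : Double k) : Coalgebra.comul (R := k) a = comulHom a := rfl

theorem counit_apply (a : Double k) : Coalgebra.counit (R := k) a = counitHom a := rfl

theorem antipodeGen_satisfiesRel : SatisfiesRel (antipodeGen (k := k)) := by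
  have r := gen_satisfiesRel (k := k)
  have m : ∀ {a b c : Double k} (d : Double k), a * b = c → a * (b * d) = c * d :=
    fun d h => by rw [← mul_assoc, h]
  have h1 : gen k .x * gen k .X = 1 - gen k .g * gen k .G - gen k .X * gen k .x := by
    rw [← r.xX]; abel
  constructor <;> simp only [antipodeGen, ← MulOpposite.op_mul, ← MulOpposite.op_neg,
    ← MulOpposite.op_add, ← MulOpposite.op_one, ← MulOpposite.op_zero, ← MulOpposite.op_sub] <;>
    congr 1 <;>
    simp only [mul_assoc, neg_mul, mul_neg, neg_neg, r.gg, r.GG, r.xx, r.XX, r.gG,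
      m _ r.gG, m _ r.gx, m _ r.gX, m _ r.Gx, m _ r.GX, mul_one,
      neg_zero, m _ h1, sub_mul, one_mul]
  all_goals abel_nf

/-- The antipode: the antihomomorphism with `S g = g`, `S G = G`, `S x = -x g`, `S X = -X G`. -/
def antipodeHom : Double k →ₐ[k] (Double k)ᵐᵒᵖ := lift antipodeGen antipodeGen_satisfiesRel

theorem antipodeHom_gen (a : Gen) : antipodeHom (gen k a) = antipodeGen a := lift_gen _ _ a

/-- The map `a ⊗ b ↦ S(a) b`. -/
def convLeft : Double k ⊗[k] Double k →ₗ[k] Double k :=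
  LinearMap.mul' k (Double k) ∘ₗ
    ((MulOpposite.opLinearEquiv k).symm.toLinearMap ∘ₗ antipodeHom.toLinearMap).rTensor (Double k)

/-- The map `a ⊗ b ↦ a S(b)`. -/
def convRight : Double k ⊗[k] Double k →ₗ[k] Double k :=
  LinearMap.mul' k (Double k) ∘ₗ
    ((MulOpposite.opLinearEquiv k).symm.toLinearMap ∘ₗ antipodeHom.toLinearMap).lTensor (Double k)

theorem convLeft_tmul (a b : Double k) :
    convLeft (a ⊗ₜ b) = (antipodeHom a).unop * b := by
  simp [convLeft]

theorem convRight_tmul (a b : Double k) :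
    convRight (a ⊗ₜ b) = a * (antipodeHom b).unop := by
  simp [convRight]

theorem convLeft_mul (u t : Double k ⊗[k] Double k) (c : k)
    (hu : convLeft u = algebraMap k _ c) : convLeft (u * t) = c • convLeft t := by
  induction t using TensorProduct.induction_on with
  | zero => simp
  | add t t' h h' => rw [mul_add, map_add, h, h', map_add, smul_add]
  | tmul a b =>
    have key : ∀ u : Double k ⊗[k] Double k,
        convLeft (u * a ⊗ₜ b) = (antipodeHom a).unop * convLeft u * b := by
      intro u
      induction u using TensorProduct.induction_on with
      | zero => simp
      | add t t' h h' => rw [add_mul, map_add, h, h', map_add, mul_add, add_mul]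
      | tmul a' b' =>
        rw [Algebra.TensorProduct.tmul_mul_tmul, convLeft_tmul, convLeft_tmul]
        simp [mul_assoc]
    rw [key, hu, convLeft_tmul, ← Algebra.commutes, mul_assoc, Algebra.smul_def]

theorem convRight_mul (u t : Double k ⊗[k] Double k) (c : k)
    (ht : convRight t = algebraMap k _ c) : convRight (u * t) = c • convRight u := by
  induction u using TensorProduct.induction_on with
  | zero => simp
  | add t t' h h' => rw [add_mul, map_add, h, h', map_add, smul_add]
  | tmul a b =>
    have key : ∀ t : Double k ⊗[k] Double k,
        convRight (a ⊗ₜ b * t) = a * convRight t * (antipodeHom b).unop := by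
      intro u
      induction u using TensorProduct.induction_on with
      | zero => simp
      | add t t' h h' => rw [mul_add, map_add, h, h', map_add, mul_add, add_mul]
      | tmul a' b' =>
        rw [Algebra.TensorProduct.tmul_mul_tmul, convRight_tmul, convRight_tmul]
        simp [mul_assoc]
    rw [key, ht, convRight_tmul, ← Algebra.commutes, mul_assoc, Algebra.smul_def]

theorem double_induction {P : Double k → Prop} (h0 : ∀ c : k, P (algebraMap k _ c))
    (h1 : ∀ a, P (gen k a)) (hm : ∀ a b, P a → P b → P (a * b))
    (ha : ∀ a b, P a → P b → P (a + b)) (a : Double k) : P a := by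
  obtain ⟨b, rfl⟩ := RingQuot.mkAlgHom_surjective k (Rel k) a
  induction b using FreeAlgebra.induction with
  | grade0 c => exact (AlgHom.commutes (RingQuot.mkAlgHom k (Rel k)) c).symm ▸ h0 c
  | grade1 a => exact h1 a
  | mul a b h h' => exact (map_mul (RingQuot.mkAlgHom k (Rel k)) a b).symm ▸ hm _ _ h h'
  | add a b h h' => exact (map_add (RingQuot.mkAlgHom k (Rel k)) a b).symm ▸ ha _ _ h h'

theorem convLeft_comul (a : Double k) :
    convLeft (comulHom a) = algebraMap k (Double k) (counitHom a) := by
  have r := gen_satisfiesRel (k := k)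
  induction a using double_induction with
  | h0 c =>
    rw [AlgHom.commutes, AlgHom.commutes, Algebra.TensorProduct.algebraMap_apply, convLeft_tmul]
    simp
  | h1 a =>
    cases a <;> simp [comulHom, comulGen, counitHom, counitGen, convLeft_tmul,
      antipodeHom_gen, antipodeGen, mul_assoc, r.gg, r.GG]
  | hm a b h h' =>
    rw [map_mul, convLeft_mul _ _ _ h, h', map_mul, map_mul, Algebra.smul_def]
  | ha a b h h' => rw [map_add, map_add, h, h', map_add, map_add]

theorem convRight_comul (a : Double k) :
    convRight (comulHom a) = algebraMap k (Double k) (counitHom a) := by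
  have r := gen_satisfiesRel (k := k)
  induction a using double_induction with
  | h0 c =>
    rw [AlgHom.commutes, AlgHom.commutes, Algebra.TensorProduct.algebraMap_apply, convRight_tmul]
    simp
  | h1 a =>
    cases a <;> simp [comulHom, comulGen, counitHom, counitGen, convRight_tmul,
      antipodeHom_gen, antipodeGen, r.gg, r.GG]
  | hm a b h h' =>
    rw [map_mul, convRight_mul _ _ _ h', h, map_mul, map_mul, Algebra.smul_def, Algebra.commutes]
  | ha a b h h' => rw [map_add, map_add, h, h', map_add, map_add]

/-- The Drinfel'd double as a Hopf algebra. -/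
instance : HopfAlgebra k (Double k) where
  antipode := (MulOpposite.opLinearEquiv k).symm.toLinearMap ∘ₗ antipodeHom.toLinearMap
  mul_antipode_rTensor_comul := LinearMap.ext convLeft_comul
  mul_antipode_lTensor_comul := LinearMap.ext convRight_comul

variable (k)

/-- The subalgebra `H_{αβ}` generated by `g`, `G` and `αx + βX`. -/
def subalgH (α β : k) : Subalgebra k (Double k) :=
  Algebra.adjoin k {gen k .g, gen k .G, α • gen k .x + β • gen k .X}

/-- The set of all subalgebras `H_{αβ}`, for `α` and `β` not both zero. -/
def familyH : Set (Subalgebra k (Double k)) :=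
  {H | ∃ α β : k, (α, β) ≠ (0, 0) ∧ H = subalgH k α β}

/-- The trivial module `k`. -/
def plusMod : ModuleCat.{u} (Double k) :=
  ModuleCat.of (Double k) (CharMod (Bialgebra.counitAlgHom k (Double k)))

/-- The one-dimensional module `k_-`, on which `g` and `G` act as `-1`, and `x` and `X` as `0`. -/
def minusMod : ModuleCat.{u} (Double k) :=
  ModuleCat.of (Double k) (CharMod (lift (k := k) minusGen minusGen_satisfiesRel))

end Structure
end Taft
end

/-!
Write `ξ` and `η` for the classes of the nonsplit extensions of one of the simple modules `k`, `k_-`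
by the other in which only `x`, respectively only `X`, acts nontrivially. They commute under the
Yoneda product, because the class of the universal extension of a simple module and that of the
radical of its projective cover have product zero. The periodic projective resolution of the middle
term of `ξ` shows that they generate: every element of `Ext^n` between simple modules is a binary
form of degree `n` in `ξ` and `η`. Over an algebraically closed field a form of positive degree has
a linear factor, so every element of `Ext^(n + 1)` is the product of some `c ξ + d η`, where
`(c, d) ≠ (0, 0)`, and an element of `Ext^n`. Now `c ξ + d η` is the class of an extension in which
`x` and `X` map the generator to `c` and `d` times the same vector. As `d x - c X` kills that
generator, the middle term is the twist by a sign of the module induced from the trivial module of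
`H_{d,-c}`. Splicing these extensions gives the required exact sequences.
-/

noncomputable section

namespace Taft

variable {k : Type u} [Field k]

section Supermodules

/-- A supermodule over the exterior algebra on two odd generators `x` and `X`, with parity
operator `s`. The double acts on it with `g` and `G` both acting as `s`; then `1 - g G` acts as
zero, so that the operators `x` and `X` anticommute. -/
structure ExteriorAction (k V : Type u) [Field k] [AddCommGroup V] [Module k V] where
  x : Module.End k V
  X : Module.End k V
  s : Module.End k V
  x_mul_x : x * x = 0
  X_mul_X : X * X = 0
  s_mul_s : s * s = 1
  s_mul_x : s * x = -(x * s)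
  s_mul_X : s * X = -(X * s)
  x_mul_X_add : x * X + X * x = 0

variable {V : Type u} [AddCommGroup V] [Module k V]

/-- The operators through which the generators of the double act. -/
def ExteriorAction.op (ρ : ExteriorAction k V) : Gen → Module.End k V
  | .x => ρ.x
  | .X => ρ.X
  | .g => ρ.s
  | .G => ρ.s

theorem ExteriorAction.op_satisfiesRel (ρ : ExteriorAction k V) : SatisfiesRel ρ.op where
  xx := ρ.x_mul_x
  XX := ρ.X_mul_X
  gg := ρ.s_mul_s
  GG := ρ.s_mul_s
  gG := rfl
  gx := ρ.s_mul_x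
  gX := ρ.s_mul_X
  Gx := ρ.s_mul_x
  GX := ρ.s_mul_X
  xX := by rw [ExteriorAction.op, ExteriorAction.op, ρ.x_mul_X_add, ExteriorAction.op,
    ExteriorAction.op, ρ.s_mul_s, sub_self]

/-- The space `V`, viewed as a module over the double through `ρ`. -/
@[nolint unusedArguments]
def Supermod (_ρ : ExteriorAction k V) : Type u := V

namespace Supermod

variable (ρ : ExteriorAction k V)

instance : AddCommGroup (Supermod ρ) := inferInstanceAs (AddCommGroup V)
instance : Module k (Supermod ρ) := inferInstanceAs (Module k V)
instance : Module (Double k) (Supermod ρ) :=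
  Module.compHom V (lift (k := k) ρ.op ρ.op_satisfiesRel).toRingHom

/-- The identity map from `V` to the module it carries. -/
def of : V ≃ₗ[k] Supermod ρ := LinearEquiv.refl k V

theorem smul_of (a : Double k) (m : V) :
    a • of ρ m = of ρ (lift (k := k) ρ.op ρ.op_satisfiesRel a m) := rfl

instance : IsScalarTower k (Double k) (Supermod ρ) where
  smul_assoc c a m := by
    obtain ⟨m, rfl⟩ := (of ρ).surjective m
    rw [smul_of, smul_of, map_smul, LinearMap.smul_apply, map_smul]

theorem gen_smul_of (a : Gen) (m : V) : gen k a • of ρ m = of ρ (ρ.op a m) := by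
  rw [smul_of, lift_gen]

variable {ρ} {M : Type*} [AddCommGroup M] [Module k M] [Module (Double k) M]
  [IsScalarTower k (Double k) M]

/-- A `k`-linear map commuting with the action of the generators, as a linear map over the
double. -/
def desc (f : V →ₗ[k] M) (hf : ∀ a m, f (ρ.op a m) = gen k a • f m) :
    Supermod ρ →ₗ[Double k] M where
  toFun m := f ((of ρ).symm m)
  map_add' := by simp
  map_smul' a m := by
    obtain ⟨m, rfl⟩ := (of ρ).surjective m
    rw [smul_of, LinearEquiv.symm_apply_apply, LinearEquiv.symm_apply_apply, RingHom.id_apply]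
    induction a using double_induction generalizing m with
    | h0 c => simp
    | h1 a => rw [lift_gen, hf]
    | hm a b ha hb => rw [map_mul, Module.End.mul_apply, ha, hb, mul_smul]
    | ha a b ha hb => rw [map_add, LinearMap.add_apply, map_add, ha, hb, add_smul]

@[simp]
theorem desc_of (f : V →ₗ[k] M) (hf : ∀ a m, f (ρ.op a m) = gen k a • f m) (m : V) :
    desc f hf (of ρ m) = f m := rfl

end Supermod

end Supermodules

section Homomorphisms

variable {U V W : Type u} [AddCommGroup U] [Module k U] [AddCommGroup V] [Module k V]
  [AddCommGroup W] [Module k W]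

/-- The `k`-linear map `f` is a homomorphism of supermodules. -/
structure Intertwines (ρ : ExteriorAction k V) (ρ' : ExteriorAction k W) (f : V →ₗ[k] W) :
    Prop where
  map_x : ∀ m, f (ρ.x m) = ρ'.x (f m)
  map_X : ∀ m, f (ρ.X m) = ρ'.X (f m)
  map_s : ∀ m, f (ρ.s m) = ρ'.s (f m)

namespace Intertwines

variable {ρ : ExteriorAction k V} {ρ' : ExteriorAction k W} {ρ'' : ExteriorAction k U}

theorem map_op {f : V →ₗ[k] W} (hf : Intertwines ρ ρ' f) (a : Gen) (m : V) :
    f (ρ.op a m) = ρ'.op a (f m) := by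
  cases a
  exacts [hf.map_x m, hf.map_X m, hf.map_s m, hf.map_s m]

theorem id (ρ : ExteriorAction k V) : Intertwines ρ ρ LinearMap.id :=
  ⟨fun _ => rfl, fun _ => rfl, fun _ => rfl⟩

theorem comp {f : V →ₗ[k] W} {g : W →ₗ[k] U} (hg : Intertwines ρ' ρ'' g)
    (hf : Intertwines ρ ρ' f) : Intertwines ρ ρ'' (g ∘ₗ f) where
  map_x m := (congrArg g (hf.map_x m)).trans (hg.map_x (f m))
  map_X m := (congrArg g (hf.map_X m)).trans (hg.map_X (f m))
  map_s m := (congrArg g (hf.map_s m)).trans (hg.map_s (f m))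

end Intertwines

/-- The object of the category of modules over the double given by `ρ`. -/
abbrev ExteriorAction.mod (ρ : ExteriorAction k V) : ModuleCat.{u} (Double k) :=
  ModuleCat.of (Double k) (Supermod ρ)

/-- The morphism in the category of modules given by a homomorphism of supermodules. -/
@[irreducible]
def homOf {ρ : ExteriorAction k V} {ρ' : ExteriorAction k W} (f : V →ₗ[k] W)
    (hf : Intertwines ρ ρ' f) : ρ.mod ⟶ ρ'.mod :=
  ModuleCat.ofHom <| Supermod.desc ((Supermod.of ρ').toLinearMap ∘ₗ f) fun a m =>
    (congrArg (Supermod.of ρ') (hf.map_op a m)).trans (Supermod.gen_smul_of ρ' a (f m)).symm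

section HomOf

variable {V₁ V₂ V₃ V₄ : Type u} [AddCommGroup V₁] [Module k V₁] [AddCommGroup V₂] [Module k V₂]
  [AddCommGroup V₃] [Module k V₃] [AddCommGroup V₄] [Module k V₄] {ρ₁ : ExteriorAction k V₁}
  {ρ₂ : ExteriorAction k V₂} {ρ₃ : ExteriorAction k V₃} {ρ₄ : ExteriorAction k V₄}

theorem homOf_of {f : V₁ →ₗ[k] V₂} (hf : Intertwines ρ₁ ρ₂ f) (m : V₁) :
    (homOf f hf).hom (Supermod.of ρ₁ m) = Supermod.of ρ₂ (f m) := by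
  rw [homOf, ModuleCat.hom_ofHom, Supermod.desc_of]
  rfl

theorem hom_ext_of {F F' : ρ₁.mod ⟶ ρ₂.mod}
    (h : ∀ m, F.hom (Supermod.of ρ₁ m) = F'.hom (Supermod.of ρ₁ m)) : F = F' := by
  ext m
  exact h ((Supermod.of ρ₁).symm m)

theorem homOf_id : homOf LinearMap.id (.id ρ₁) = 𝟙 ρ₁.mod :=
  hom_ext_of fun m => homOf_of (.id ρ₁) m

theorem homOf_comp {f : V₁ →ₗ[k] V₂} {g : V₂ →ₗ[k] V₃} (hf : Intertwines ρ₁ ρ₂ f)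
    (hg : Intertwines ρ₂ ρ₃ g) :
    homOf f hf ≫ homOf g hg = homOf (g ∘ₗ f) (hg.comp hf) :=
  hom_ext_of fun m => by
    rw [ModuleCat.hom_comp, LinearMap.comp_apply, homOf_of, homOf_of, homOf_of,
      LinearMap.comp_apply]

theorem homOf_comp_eq_zero {f : V₁ →ₗ[k] V₂} {g : V₂ →ₗ[k] V₃} {hf : Intertwines ρ₁ ρ₂ f}
    {hg : Intertwines ρ₂ ρ₃ g} (h : g ∘ₗ f = 0) : homOf f hf ≫ homOf g hg = 0 :=
  hom_ext_of fun m => by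
    rw [homOf_comp, homOf_of, h]
    rfl

theorem homOf_comp_eq_homOf_comp {f : V₁ →ₗ[k] V₂} {g : V₂ →ₗ[k] V₄} {f' : V₁ →ₗ[k] V₃}
    {g' : V₃ →ₗ[k] V₄} {hf : Intertwines ρ₁ ρ₂ f} {hg : Intertwines ρ₂ ρ₄ g}
    {hf' : Intertwines ρ₁ ρ₃ f'} {hg' : Intertwines ρ₃ ρ₄ g'} (h : g ∘ₗ f = g' ∘ₗ f') :
    homOf f hf ≫ homOf g hg = homOf f' hf' ≫ homOf g' hg' := by
  rw [homOf_comp, homOf_comp]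
  congr 1

theorem shortExact_homOf {i : V₁ →ₗ[k] V₂} {p : V₂ →ₗ[k] V₃} (hi : Intertwines ρ₁ ρ₂ i)
    (hp : Intertwines ρ₂ ρ₃ p) (inj : Function.Injective i) (surj : Function.Surjective p)
    (exact : Function.Exact i p) (w : homOf i hi ≫ homOf p hp = 0) :
    (ShortComplex.mk _ _ w).ShortExact := by
  unfold homOf
  exact ModuleCat.shortComplex_shortExact _ (fun m => exact m) inj surj

end HomOf

end Homomorphisms

section Examples

variable (k) {W : Type u} [AddCommGroup W] [Module k W] (e : ℤˣ)

/-- The module `W` on which `x` and `X` act as zero, and `g` and `G` as the sign `e`. -/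
@[simps]
def isotypic (W : Type u) [AddCommGroup W] [Module k W] : ExteriorAction k W where
  x := 0
  X := 0
  s := e • 1
  x_mul_x := mul_zero _
  X_mul_X := mul_zero _
  s_mul_s := by rcases Int.units_eq_one_or e with rfl | rfl <;> simp
  s_mul_x := by simp
  s_mul_X := by simp
  x_mul_X_add := by simp

/-- The simple module of sign `e`. -/
abbrev simpleMod : ModuleCat.{u} (Double k) := (isotypic k e k).mod

/-- The extension of the simple module of sign `e` by `W` in which `x` and `X` map the generator
to `u` and `v`. -/
@[simps]
def extension (u v : W) : ExteriorAction k (k × W) where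
  x := LinearMap.inr k k W ∘ₗ LinearMap.toSpanSingleton k W u ∘ₗ LinearMap.fst k k W
  X := LinearMap.inr k k W ∘ₗ LinearMap.toSpanSingleton k W v ∘ₗ LinearMap.fst k k W
  s := (e • LinearMap.id).prodMap (-e • LinearMap.id)
  x_mul_x := by ext <;> simp
  X_mul_X := by ext <;> simp
  s_mul_s := by rcases Int.units_eq_one_or e with rfl | rfl <;> ext <;> simp
  s_mul_x := by rcases Int.units_eq_one_or e with rfl | rfl <;> ext <;> simp
  s_mul_X := by rcases Int.units_eq_one_or e with rfl | rfl <;> ext <;> simp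
  x_mul_X_add := by ext <;> simp

/-- The projective cover of the simple module of sign `e`, with basis `1`, `x`, `X`, `x X`. -/
@[simps]
def projectiveCover : ExteriorAction k (k × k × k × k) where
  x :=
    { toFun := fun m => (0, m.1, 0, m.2.2.1)
      map_add' := by simp
      map_smul' := by simp }
  X :=
    { toFun := fun m => (0, 0, m.1, -m.2.1)
      map_add' := by simp [add_comm]
      map_smul' := by simp }
  s :=
    { toFun := fun m => (e • m.1, -(e • m.2.1), -(e • m.2.2.1), e • m.2.2.2)
      map_add' := by simp [add_comm]
      map_smul' := by simp [mul_smul_comm] }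
  x_mul_x := LinearMap.ext fun _ => by simp
  X_mul_X := LinearMap.ext fun _ => by simp
  s_mul_s := LinearMap.ext fun m => by simp [← mul_smul]
  s_mul_x := LinearMap.ext fun m => by simp
  s_mul_X := LinearMap.ext fun m => by simp
  x_mul_X_add := LinearMap.ext fun m => by simp

end Examples

section GeneratorRelations

variable {M : Type*} [AddCommGroup M] [Module (Double k) M] (m : M)

theorem x_smul_x_smul : gen k .x • gen k .x • m = 0 := by
  rw [← mul_smul, gen_satisfiesRel.xx, zero_smul]

theorem X_smul_X_smul : gen k .X • gen k .X • m = 0 := by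
  rw [← mul_smul, gen_satisfiesRel.XX, zero_smul]

theorem g_smul_x_smul : gen k .g • gen k .x • m = -(gen k .x • gen k .g • m) := by
  rw [← mul_smul, gen_satisfiesRel.gx, neg_smul, mul_smul]

theorem g_smul_X_smul : gen k .g • gen k .X • m = -(gen k .X • gen k .g • m) := by
  rw [← mul_smul, gen_satisfiesRel.gX, neg_smul, mul_smul]

theorem G_smul_x_smul : gen k .G • gen k .x • m = -(gen k .x • gen k .G • m) := by
  rw [← mul_smul, gen_satisfiesRel.Gx, neg_smul, mul_smul]

theorem G_smul_X_smul : gen k .G • gen k .X • m = -(gen k .X • gen k .G • m) := by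
  rw [← mul_smul, gen_satisfiesRel.GX, neg_smul, mul_smul]

theorem X_smul_x_smul :
    gen k .X • gen k .x • m = m - gen k .g • gen k .G • m - gen k .x • gen k .X • m := by
  rw [eq_sub_iff_add_eq', ← mul_smul, ← mul_smul, ← add_smul, gen_satisfiesRel.xX, sub_smul,
    one_smul, mul_smul]

end GeneratorRelations

section Projectivity

variable {M : Type*} [AddCommGroup M] [Module (Double k) M]

theorem projectiveCover_hom_ext {e : ℤˣ} {f f' : Supermod (projectiveCover k e) →ₗ[Double k] M}
    (h : f (Supermod.of _ (1, 0, 0, 0)) = f' (Supermod.of _ (1, 0, 0, 0))) : f = f' := by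
  ext m
  obtain ⟨⟨a, b, c, d⟩, rfl⟩ := (Supermod.of _).surjective m
  have hm : Supermod.of (projectiveCover k e) (a, b, c, d) =
      (algebraMap k (Double k) a + algebraMap k (Double k) b * gen k .x +
        algebraMap k (Double k) c * gen k .X + algebraMap k (Double k) d * gen k .x * gen k .X) •
        Supermod.of (projectiveCover k e) (1, 0, 0, 0) := by
    simp [add_smul, mul_smul, Supermod.gen_smul_of, ExteriorAction.op, ← map_smul, ← map_add]
  rw [hm, map_smul, map_smul, h]

variable [Module k M] [IsScalarTower k (Double k) M]

/-- The homomorphism from the projective cover which maps the generator to a given vector `w` of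
sign `e`. -/
def projectiveCoverLift {e : ℤˣ} {w : M} (hg : gen k .g • w = e • w) (hG : gen k .G • w = e • w) :
    Supermod (projectiveCover k e) →ₗ[Double k] M :=
  Supermod.desc
    ((LinearMap.toSpanSingleton k M w).coprod <|
      (LinearMap.toSpanSingleton k M (gen k .x • w)).coprod <|
      (LinearMap.toSpanSingleton k M (gen k .X • w)).coprod <|
      LinearMap.toSpanSingleton k M (gen k .x • gen k .X • w)) fun a m => by
    rcases Int.units_eq_one_or e with rfl | rfl <;> cases a <;>
      simp [ExteriorAction.op, smul_comm _ m.1, smul_comm _ m.2.1, smul_comm _ m.2.2.1,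
        smul_comm _ m.2.2.2, x_smul_x_smul, X_smul_X_smul, X_smul_x_smul, g_smul_x_smul,
        g_smul_X_smul, G_smul_x_smul, G_smul_X_smul, hg, hG]

variable (k) in
/-- The idempotent which projects onto the vectors on which `g` and `G` act as the sign `e`. -/
def signIdempotent (e : ℤˣ) : Double k :=
  ((2⁻¹ : k) • (1 + e • gen k .g)) * ((2⁻¹ : k) • (1 + e • gen k .G))

theorem mul_smul_one_add_units_smul {A : Type*} [Ring A] [Algebra k A] {a : A} (ha : a * a = 1)
    (c : k) (e : ℤˣ) : a * (c • (1 + e • a)) = e • (c • (1 + e • a)) := by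
  rcases Int.units_eq_one_or e with rfl | rfl <;> simp [mul_add, ← smul_neg, ha, add_comm]

theorem g_mul_signIdempotent (e : ℤˣ) :
    gen k .g * signIdempotent k e = e • signIdempotent k e := by
  rw [signIdempotent, ← mul_assoc, mul_smul_one_add_units_smul gen_satisfiesRel.gg,
    smul_mul_assoc]

theorem G_mul_signIdempotent (e : ℤˣ) :
    gen k .G * signIdempotent k e = e • signIdempotent k e := by
  have hcomm : Commute (gen k .G) ((2⁻¹ : k) • (1 + e • gen k .g)) :=
    ((Commute.one_right _).add_right (Commute.smul_right gen_satisfiesRel.gG.symm e)).smul_right _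
  rw [signIdempotent, ← mul_assoc, hcomm.eq, mul_assoc,
    mul_smul_one_add_units_smul gen_satisfiesRel.GG, mul_smul_comm]

theorem signIdempotent_smul (h2 : (2 : k) ≠ 0) {e : ℤˣ} {w : M} (hg : gen k .g • w = e • w)
    (hG : gen k .G • w = e • w) : signIdempotent k e • w = w := by
  have average {a : Double k} (ha : a • w = e • w) : ((2⁻¹ : k) • (1 + e • a)) • w = w := by
    have hsum : (1 + e • a) • w = (2 : k) • w := by
      rcases Int.units_eq_one_or e with rfl | rfl <;> simp [add_smul, ha, two_smul]
    rw [smul_assoc, hsum, inv_smul_smul₀ h2]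
  rw [signIdempotent, mul_smul, average hG, average hg]

theorem projective_projectiveCover (h2 : (2 : k) ≠ 0) (e : ℤˣ) :
    Projective (projectiveCover k e).mod := by
  have hs : (projectiveCover k e).s (1, 0, 0, 0) = e • (1, 0, 0, 0) := by simp
  have hg : gen k .g • Supermod.of (projectiveCover k e) (1, 0, 0, 0) =
      e • Supermod.of (projectiveCover k e) (1, 0, 0, 0) :=
    (Supermod.gen_smul_of _ _ _).trans (congrArg _ hs)
  have hG : gen k .G • Supermod.of (projectiveCover k e) (1, 0, 0, 0) =
      e • Supermod.of (projectiveCover k e) (1, 0, 0, 0) :=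
    (Supermod.gen_smul_of _ _ _).trans (congrArg _ hs)
  have : Module.Projective (Double k) (Supermod (projectiveCover k e)) :=
    .of_split
      (projectiveCoverLift (g_mul_signIdempotent e) (G_mul_signIdempotent e))
      (LinearMap.toSpanSingleton (Double k) _ (Supermod.of _ (1, 0, 0, 0)))
      (projectiveCover_hom_ext (by simp [projectiveCoverLift, signIdempotent_smul h2 hg hG]))
  exact (IsProjective.iff_projective _).1 this

end Projectivity

section ShortExactSequences

variable (k) {W W' : Type u} [AddCommGroup W] [Module k W] [AddCommGroup W'] [Module k W']
  (e : ℤˣ) (u v : W)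

/-- The functoriality of `isotypic` in the vector space. -/
def isotypicMap (φ : W →ₗ[k] W') : (isotypic k e W).mod ⟶ (isotypic k e W').mod :=
  homOf φ (by constructor <;> simp [Units.smul_def])

/-- The inclusion of the submodule `W` of an extension. -/
def extensionι : (isotypic k (-e) W).mod ⟶ (extension k e u v).mod :=
  homOf (LinearMap.inr k k W) (by constructor <;> simp)

/-- The projection of an extension onto its simple quotient. -/
def extensionπ : (extension k e u v).mod ⟶ simpleMod k e :=
  homOf (LinearMap.fst k k W) (by constructor <;> simp)

/-- The short exact sequence of an extension. -/
def extensionSeq : ShortComplex (ModuleCat.{u} (Double k)) :=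
  .mk (extensionι k e u v) (extensionπ k e u v) (homOf_comp_eq_zero (by ext; simp))

theorem extensionSeq_shortExact : (extensionSeq k e u v).ShortExact :=
  shortExact_homOf _ _ LinearMap.inr_injective LinearMap.fst_surjective Function.Exact.inr_fst _

/-- The pushout of an extension along a linear map. -/
def extensionSeqMap (φ : W →ₗ[k] W') : extensionSeq k e u v ⟶ extensionSeq k e (φ u) (φ v) where
  τ₁ := isotypicMap k (-e) φ
  τ₂ := homOf (LinearMap.id.prodMap φ)
    (by constructor <;> simp [Units.smul_def])
  τ₃ := homOf LinearMap.id (.id _)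
  comm₁₂ := homOf_comp_eq_homOf_comp (by ext <;> simp)
  comm₂₃ := homOf_comp_eq_homOf_comp (by ext <;> simp)

/-- The extension of the simple module of sign `e` by all of its first extension group. -/
abbrev universalExtension : ExteriorAction k (k × k × k) := extension k e (1, 0) (0, 1)

/-- The short exact sequence of the socle of the projective cover, whose quotient is the universal
extension. -/
def socleSeq : ShortComplex (ModuleCat.{u} (Double k)) where
  X₁ := simpleMod k (- -e)
  X₂ := (projectiveCover k e).mod
  X₃ := (universalExtension k e).mod
  f := homOf (LinearMap.inr k k _ ∘ₗ LinearMap.inr k k _ ∘ₗ LinearMap.inr k k k)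
    (by constructor <;> simp)
  g := homOf (LinearMap.id.prodMap (LinearMap.id.prodMap (LinearMap.fst k k k)))
    (by constructor <;> simp)
  zero := homOf_comp_eq_zero (by ext <;> simp)

theorem socleSeq_shortExact : (socleSeq k e).ShortExact := by
  refine shortExact_homOf _ _ ?_ ?_ ?_ _
  · exact fun a b => by simp
  · rintro ⟨a, b, c⟩
    exact ⟨(a, b, c, 0), rfl⟩
  · rintro ⟨a, b, c, d⟩
    simp [Prod.ext_iff, eq_comm]

/-- The vector `(c, d)` of the universal extension spans a simple module. It lifts to the multiple
`c x + d X` of the generator of the projective cover, which generates the given extension. -/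
def extensionSeqToSocleSeq (c d : k) : extensionSeq k (-e) d (-c) ⟶ socleSeq k e where
  τ₁ := homOf LinearMap.id (.id _)
  τ₂ := homOf (W := k × k × k × k) ((0 : k × k →ₗ[k] k).prod
      ((c • LinearMap.fst k k k).prod ((d • LinearMap.fst k k k).prod (LinearMap.snd k k k))))
    (by constructor <;> simp [Units.smul_def, mul_comm, mul_assoc])
  τ₃ := homOf (LinearMap.inr k k (k × k) ∘ₗ LinearMap.toSpanSingleton k (k × k) (c, d))
    (by constructor <;> simp [Units.smul_def, mul_comm, mul_assoc])
  comm₁₂ := homOf_comp_eq_homOf_comp (by ext <;> simp)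
  comm₂₃ := homOf_comp_eq_homOf_comp (by ext <;> simp)

/-- The short exact sequence of the kernel of the projective cover of the extension in which `x`
maps the generator to `1` and `X` maps it to `0`. -/
def syzygySeq : ShortComplex (ModuleCat.{u} (Double k)) where
  X₁ := (extension k (-e) (1 : k) 0).mod
  X₂ := (projectiveCover k e).mod
  X₃ := (extension k e (1 : k) 0).mod
  f := homOf (LinearMap.inr k k _ ∘ₗ LinearMap.inr k k _)
    (by constructor <;> simp [Prod.zero_eq_mk])
  g := homOf (LinearMap.id.prodMap (LinearMap.fst k k _))
    (by constructor <;> simp)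
  zero := homOf_comp_eq_zero (by ext <;> simp)

theorem syzygySeq_shortExact : (syzygySeq k e).ShortExact := by
  refine shortExact_homOf _ _ ?_ ?_ ?_ _
  · exact fun a b => by simp
  · rintro ⟨a, b⟩
    exact ⟨(a, b, 0, 0), rfl⟩
  · rintro ⟨a, b, c, d⟩
    simp [Prod.ext_iff, eq_comm]

/-- The quotient of the projective cover by `x` and `x X` is the extension in which the roles of `x`
and `X` are exchanged. -/
def syzygySeqToExtensionSeq : syzygySeq k e ⟶ extensionSeq k e (0 : k) 1 where
  τ₁ := extensionπ k (-e) 1 0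
  τ₂ := homOf (LinearMap.id.prodMap (LinearMap.fst k k _ ∘ₗ LinearMap.snd k k _))
    (by constructor <;> simp)
  τ₃ := extensionπ k e 1 0
  comm₁₂ := homOf_comp_eq_homOf_comp (by ext <;> simp)
  comm₂₃ := homOf_comp_eq_homOf_comp (by ext <;> simp)

end ShortExactSequences

section ExtensionClasses

open Abelian

open scoped ModuleCat.Algebra

variable (k) {W W' : Type u} [AddCommGroup W] [Module k W] [AddCommGroup W'] [Module k W']
  (e : ℤˣ)

theorem isotypicMap_add (φ ψ : W →ₗ[k] W') :
    isotypicMap k e (φ + ψ) = isotypicMap k e φ + isotypicMap k e ψ :=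
  hom_ext_of fun m => by
    rw [ModuleCat.hom_add, LinearMap.add_apply, isotypicMap, isotypicMap, isotypicMap, homOf_of,
      homOf_of, homOf_of, LinearMap.add_apply, map_add]

theorem smul_eq_comp_isotypicMap (c : k) {M : ModuleCat.{u} (Double k)} {n : ℕ}
    (ξ : Ext M (isotypic k e W).mod n) :
    c • ξ = ξ.comp (Ext.mk₀ (isotypicMap k e (c • LinearMap.id))) (add_zero n) := by
  rw [Ext.smul_eq_comp_mk₀]
  congr 2
  refine hom_ext_of fun m => ?_
  rw [isotypicMap, homOf_of, LinearMap.smul_apply, LinearMap.id_apply, map_smul]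
  exact algebraMap_smul (Double k) c (Supermod.of (isotypic k e W) m)

/-- The class of an extension of the simple module of sign `e` by `W`. -/
def extensionClass (u v : W) : Ext (simpleMod k e) (isotypic k (-e) W).mod 1 :=
  (extensionSeq_shortExact k e u v).extClass

theorem extensionClass_comp_isotypicMap (u v : W) (φ : W →ₗ[k] W') :
    (extensionClass k e u v).comp (Ext.mk₀ (isotypicMap k (-e) φ)) (add_zero 1) =
      extensionClass k e (φ u) (φ v) := by
  have hτ₃ : (extensionSeqMap k e u v φ).τ₃ = 𝟙 (simpleMod k e) := homOf_id
  have h := ShortComplex.ShortExact.extClass_naturality (extensionSeq_shortExact k e u v)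
    (extensionSeq_shortExact k e (φ u) (φ v)) (extensionSeqMap k e u v φ)
  rw [hτ₃] at h
  exact h.trans (Ext.mk₀_id_comp _)

theorem extensionClass_eq_add (u v : W) :
    extensionClass k e u v =
      (extensionClass k e (1 : k) 0).comp
        (Ext.mk₀ (isotypicMap k (-e) (LinearMap.toSpanSingleton k W u))) (add_zero 1) +
      (extensionClass k e (0 : k) 1).comp
        (Ext.mk₀ (isotypicMap k (-e) (LinearMap.toSpanSingleton k W v))) (add_zero 1) := by
  have h (φ : k × k →ₗ[k] W) := extensionClass_comp_isotypicMap k e ((1, 0) : k × k) (0, 1) φ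
  calc extensionClass k e u v
    _ = (extensionClass k e ((1, 0) : k × k) (0, 1)).comp (Ext.mk₀ (isotypicMap k (-e)
          (LinearMap.toSpanSingleton k W u ∘ₗ LinearMap.fst k k k +
            LinearMap.toSpanSingleton k W v ∘ₗ LinearMap.snd k k k))) (add_zero 1) := by
      rw [h]
      simp
    _ = extensionClass k e ((1 : k) • u) ((0 : k) • u) +
          extensionClass k e ((0 : k) • v) ((1 : k) • v) := by
      rw [isotypicMap_add, Ext.mk₀_add, Ext.comp_add, h, h]
      rfl
    _ = _ := by
      rw [extensionClass_comp_isotypicMap, extensionClass_comp_isotypicMap]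
      rfl

theorem extensionClass_eq_smul_add_smul (c d : k) :
    extensionClass k e c d =
      c • extensionClass k e (1 : k) 0 + d • extensionClass k e (0 : k) 1 := by
  rw [smul_eq_comp_isotypicMap, smul_eq_comp_isotypicMap, extensionClass_comp_isotypicMap,
    extensionClass_comp_isotypicMap, extensionClass_eq_add, extensionClass_comp_isotypicMap,
    extensionClass_comp_isotypicMap]
  simp

/-- The class of the extension given by `socleSeq`. -/
def socleClass : Ext (universalExtension k e).mod (simpleMod k (- -e)) 1 :=
  (socleSeq_shortExact k e).extClass

/-- The class of the radical of the projective cover, as an extension of its two middle composition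
factors by the socle. -/
def radicalClass : Ext (isotypic k (-e) (k × k)).mod (simpleMod k (- -e)) 1 :=
  (Ext.mk₀ (extensionι k e (1, 0) (0, 1))).comp (socleClass k e) (zero_add 1)

theorem isotypicMap_comp_radicalClass (c d : k) :
    (Ext.mk₀ (isotypicMap k (-e) (LinearMap.toSpanSingleton k (k × k) (c, d)))).comp
      (radicalClass k e) (zero_add 1) = extensionClass k (-e) d (-c) := by
  have hτ₁ : (extensionSeqToSocleSeq k e c d).τ₁ = 𝟙 (simpleMod k (- -e)) := homOf_id
  have h := ShortComplex.ShortExact.extClass_naturality (extensionSeq_shortExact k (-e) d (-c))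
    (socleSeq_shortExact k e) (extensionSeqToSocleSeq k e c d)
  rw [hτ₁] at h
  rw [radicalClass, Ext.mk₀_comp_mk₀_assoc, isotypicMap, extensionι, homOf_comp]
  exact h.symm.trans (Ext.comp_mk₀_id _)

theorem extensionClass_comp_radicalClass :
    (extensionClass k e ((1, 0) : k × k) (0, 1)).comp (radicalClass k e) (rfl : 1 + 1 = 2) = 0 := by
  have h : (extensionClass k e ((1, 0) : k × k) (0, 1)).comp
      (Ext.mk₀ (extensionι k e ((1, 0) : k × k) (0, 1))) (add_zero 1) = 0 :=
    (extensionSeq_shortExact k e ((1, 0) : k × k) (0, 1)).extClass_comp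
  rw [radicalClass, ← Ext.comp_assoc_of_second_deg_zero, h, Ext.zero_comp]

theorem extensionClass_comp_comm :
    (extensionClass k e (1 : k) 0).comp (extensionClass k (-e) (0 : k) 1) (rfl : 1 + 1 = 2) =
      (extensionClass k e (0 : k) 1).comp (extensionClass k (-e) (1 : k) 0) rfl := by
  have h := extensionClass_comp_radicalClass k e
  rw [extensionClass_eq_add, Ext.add_comp, Ext.comp_assoc_of_second_deg_zero,
    Ext.comp_assoc_of_second_deg_zero, isotypicMap_comp_radicalClass,
    isotypicMap_comp_radicalClass, extensionClass_eq_smul_add_smul k (-e) 0 (-1)] at h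
  simpa [add_eq_zero_iff_eq_neg, neg_add_eq_zero] using h

/-- The class of the extension given by `syzygySeq`. -/
def syzygyClass : Ext (extension k e (1 : k) 0).mod (extension k (-e) (1 : k) 0).mod 1 :=
  (syzygySeq_shortExact k e).extClass

theorem syzygyClass_comp_extensionπ :
    (syzygyClass k e).comp (Ext.mk₀ (extensionπ k (-e) 1 0)) (add_zero 1) =
      (Ext.mk₀ (extensionπ k e 1 0)).comp (extensionClass k e (0 : k) 1) (zero_add 1) :=
  ShortComplex.ShortExact.extClass_naturality (syzygySeq_shortExact k e)
    (extensionSeq_shortExact k e (0 : k) 1) (syzygySeqToExtensionSeq k e)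

variable {k}

theorem exists_eq_syzygyClass_comp (h2 : (2 : k) ≠ 0) {N : ModuleCat.{u} (Double k)} {n : ℕ}
    (y : Ext (extension k e (1 : k) 0).mod N (n + 1)) :
    ∃ z : Ext (extension k (-e) (1 : k) 0).mod N n,
      y = (syzygyClass k e).comp z (add_comm 1 n) := by
  have := projective_projectiveCover h2 e
  obtain ⟨z, hz⟩ := Ext.contravariant_sequence_exact₃ (syzygySeq_shortExact k e) N y
    (Ext.eq_zero_of_projective (P := (projectiveCover k e).mod) _) (add_comm 1 n)
  exact ⟨z, hz.symm⟩

theorem exists_eq_extensionClass_comp_of_extensionπ_comp_eq_zero {u v : W}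
    {N : ModuleCat.{u} (Double k)} {n : ℕ} {z : Ext (simpleMod k e) N (n + 1)}
    (hz : (Ext.mk₀ (extensionπ k e u v)).comp z (zero_add _) = 0) :
    ∃ y : Ext (isotypic k (-e) W).mod N n, z = (extensionClass k e u v).comp y (add_comm 1 n) := by
  obtain ⟨y, hy⟩ := Ext.contravariant_sequence_exact₃ (extensionSeq_shortExact k e u v) N z hz
    (add_comm 1 n)
  exact ⟨y, hy.symm⟩

end ExtensionClasses

section HomSpaces

variable {V V' W W' : Type u} [AddCommGroup V] [Module k V] [AddCommGroup V'] [Module k V']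
  [AddCommGroup W] [Module k W] [AddCommGroup W'] [Module k W']

theorem exists_eq_homOf {ρ : ExteriorAction k V} {ρ' : ExteriorAction k V'} (F : ρ.mod ⟶ ρ'.mod) :
    ∃ (f : V →ₗ[k] V') (hf : Intertwines ρ ρ' f), F = homOf f hf := by
  let f : V →ₗ[k] V' :=
    (Supermod.of ρ').symm.toLinearMap ∘ₗ F.hom.restrictScalars k ∘ₗ (Supermod.of ρ).toLinearMap
  have hf (a : Gen) (m : V) : f (ρ.op a m) = ρ'.op a (f m) :=
    (Supermod.of ρ').injective <| by
      rw [← Supermod.gen_smul_of]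
      exact (congrArg F.hom (Supermod.gen_smul_of ρ a m).symm).trans (F.hom.map_smul _ _)
  exact ⟨f, ⟨hf .x, hf .X, hf .g⟩, hom_ext_of fun m => (homOf_of (f := f) _ m).symm⟩

theorem exists_eq_isotypicMap {e : ℤˣ} (F : (isotypic k e W).mod ⟶ (isotypic k e W').mod) :
    ∃ φ : W →ₗ[k] W', F = isotypicMap k e φ :=
  let ⟨φ, _, h⟩ := exists_eq_homOf F
  ⟨φ, h⟩

theorem eq_zero_of_isotypic_hom (h2 : (2 : k) ≠ 0) {e t : ℤˣ} (het : e ≠ t)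
    (F : (isotypic k e W).mod ⟶ (isotypic k t W').mod) : F = 0 := by
  obtain ⟨f, hf, rfl⟩ := exists_eq_homOf F
  have hf0 : f = 0 := by
    ext m
    have hm : -(t • f m) = t • f m := by
      simpa [Int.units_ne_iff_eq_neg.1 het, Units.smul_def] using hf.map_s m
    have : (2 : k) • t • f m = 0 := by rw [two_smul, ← sub_neg_eq_add, hm, sub_self]
    simpa [h2, smul_eq_zero_iff_eq] using this
  exact hom_ext_of fun m => by
    rw [homOf_of, hf0]
    rfl

theorem extensionι_comp_eq_zero {e t : ℤˣ}
    (F : (extension k e (1 : k) 0).mod ⟶ (isotypic k t W).mod) :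
    extensionι k e (1 : k) 0 ≫ F = 0 := by
  obtain ⟨f, hf, rfl⟩ := exists_eq_homOf F
  refine homOf_comp_eq_zero (LinearMap.ext_ring ?_)
  simpa using hf.map_x (1, 0)

/-- A basis vector of the space of morphisms between two simple modules, or zero if that space
vanishes. -/
def kroneckerHom (e t : ℤˣ) : simpleMod k e ⟶ simpleMod k t :=
  homOf (if e = t then LinearMap.id else 0) (by
    split_ifs with h
    · exact h ▸ .id _
    · constructor <;> simp)

theorem exists_eq_kroneckerHom_comp (h2 : (2 : k) ≠ 0) {e t : ℤˣ}
    (F : simpleMod k e ⟶ simpleMod k t) :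
    ∃ a : k, F = kroneckerHom e t ≫ isotypicMap k t (a • LinearMap.id) := by
  by_cases h : e = t
  · subst h
    obtain ⟨φ, rfl⟩ := exists_eq_isotypicMap F
    refine ⟨φ 1, ?_⟩
    rw [kroneckerHom, isotypicMap, isotypicMap, homOf_comp]
    congr 1
    ext
    simp
  · exact ⟨0, by rw [eq_zero_of_isotypic_hom h2 h F, eq_zero_of_isotypic_hom h2 h (_ ≫ _)]⟩

end HomSpaces

section Forms

open Abelian

open scoped ModuleCat.Algebra

/-- The product of the class of `extension k _ 0 1` taken `i` times and that of `extension k _ 1 0`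
taken `n - i` times. Only `i ≤ n` is meaningful. -/
def monomialClass (t : ℤˣ) : (n i : ℕ) → (e : ℤˣ) → Ext (simpleMod k e) (simpleMod k t) n
  | 0, _, e => Ext.mk₀ (kroneckerHom e t)
  | n + 1, 0, e => (extensionClass k e 1 0).comp (monomialClass t n 0 (-e)) (add_comm 1 n)
  | n + 1, i + 1, e => (extensionClass k e 0 1).comp (monomialClass t n i (-e)) (add_comm 1 n)

theorem extensionClass_comp_monomialClass (t e : ℤˣ) {n i : ℕ} (hi : i ≤ n) :
    (extensionClass k e 1 0).comp (monomialClass t n i (-e)) (add_comm 1 n) =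
      monomialClass t (n + 1) i e := by
  induction n generalizing i e with
  | zero => cases Nat.le_zero.1 hi; rfl
  | succ n ih =>
    cases i with
    | zero => rfl
    | succ i =>
      rw [monomialClass, monomialClass, ← ih (-e) (Nat.le_of_succ_le_succ hi),
        ← Ext.comp_assoc _ _ _ (rfl : 1 + 1 = 2) _ (by omega), extensionClass_comp_comm,
        Ext.comp_assoc _ _ _ _ (add_comm 1 n) (by omega)]

/-- The binary form of degree `n` whose dehomogenization is the polynomial `p`, evaluated at the
classes of `extension k _ 1 0` and `extension k _ 0 1`. -/
def formClass (t : ℤˣ) (n : ℕ) (e : ℤˣ) :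
    Polynomial k →ₗ[k] Ext (simpleMod k e) (simpleMod k t) n :=
  Polynomial.lsum fun i => LinearMap.toSpanSingleton k _ (monomialClass t n i e)

open Polynomial in
theorem formClass_monomial (t e : ℤˣ) (n i : ℕ) (a : k) :
    formClass t n e (monomial i a) = a • monomialClass t n i e := by
  simp [formClass]

open Polynomial in
theorem formClass_mul (t e : ℤˣ) {n : ℕ} (c d : k) {q : k[X]} (hq : q.natDegree ≤ n) :
    formClass t (n + 1) e ((C c + C d * X) * q) =
      (extensionClass k e c d).comp (formClass t n (-e) q) (add_comm 1 n) := by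
  have hmonomial (i : ℕ) (hi : i ∈ Finset.range (n + 1)) (a : k) :
      formClass t (n + 1) e ((C c + C d * X) * monomial i a) =
        (extensionClass k e c d).comp (formClass t n (-e) (monomial i a)) (add_comm 1 n) := by
    have hmul : (C c + C d * X) * monomial i a = monomial i (c * a) + monomial (i + 1) (d * a) := by
      rw [add_mul, C_mul_monomial, mul_assoc, X_mul_monomial, C_mul_monomial]
    rw [hmul, map_add, formClass_monomial, formClass_monomial, formClass_monomial,
      extensionClass_eq_smul_add_smul, Ext.add_comp, Ext.comp_smul, Ext.comp_smul, Ext.smul_comp,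
      Ext.smul_comp, extensionClass_comp_monomialClass t e (Finset.mem_range_succ_iff.1 hi),
      monomialClass, mul_comm c, mul_comm d, mul_smul, mul_smul]
  rw [q.as_sum_range' (n + 1) (Nat.lt_succ_of_le hq), Finset.mul_sum, map_sum, map_sum,
    Finset.sum_congr rfl fun i hi => hmonomial i hi _]
  exact (map_sum ((extensionClass k e c d).precomp _ (add_comm 1 n)) _ _).symm

theorem exists_eq_smul_monomialClass (h2 : (2 : k) ≠ 0) {t e : ℤˣ}
    (z : Ext (simpleMod k e) (simpleMod k t) 0) :
    ∃ a : k, z = a • monomialClass t 0 0 e := by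
  obtain ⟨F, rfl⟩ := (Ext.mk₀_bijective _ _).surjective z
  obtain ⟨a, rfl⟩ := exists_eq_kroneckerHom_comp h2 F
  refine ⟨a, ?_⟩
  rw [monomialClass, smul_eq_comp_isotypicMap, Ext.mk₀_comp_mk₀]

theorem exists_eq_smul_extensionπ_comp_monomialClass (h2 : (2 : k) ≠ 0) {t : ℤˣ} {n : ℕ} {e : ℤˣ}
    (y : Ext (extension k e (1 : k) 0).mod (simpleMod k t) n) :
    ∃ a : k, y = a • (Ext.mk₀ (extensionπ k e 1 0)).comp (monomialClass t n n e) (zero_add n) := by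
  induction n generalizing e with
  | zero =>
    obtain ⟨F, rfl⟩ := (Ext.mk₀_bijective _ _).surjective y
    obtain ⟨z, hz⟩ := Ext.contravariant_sequence_exact₂ (extensionSeq_shortExact k e (1 : k) 0) _
      (Ext.mk₀ F) ((Ext.mk₀_comp_mk₀ _ F).trans <|
        (congrArg Ext.mk₀ (extensionι_comp_eq_zero F)).trans (Ext.mk₀_zero _ _))
    obtain ⟨a, rfl⟩ := exists_eq_smul_monomialClass h2 z
    exact ⟨a, hz.symm.trans (Ext.comp_smul _ _ _ a)⟩
  | succ n ih =>
    obtain ⟨z, rfl⟩ := exists_eq_syzygyClass_comp e h2 y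
    obtain ⟨a, rfl⟩ := ih z
    refine ⟨a, ?_⟩
    rw [Ext.comp_smul, monomialClass, ← Ext.comp_assoc_of_second_deg_zero,
      syzygyClass_comp_extensionπ, Ext.comp_assoc _ _ _ (zero_add 1) (add_comm 1 n) (by omega)]

open Polynomial in
theorem exists_eq_formClass (h2 : (2 : k) ≠ 0) {t : ℤˣ} {n : ℕ} {e : ℤˣ}
    (z : Ext (simpleMod k e) (simpleMod k t) n) :
    ∃ p : k[X], p.natDegree ≤ n ∧ z = formClass t n e p := by
  induction n generalizing e with
  | zero =>
    obtain ⟨a, rfl⟩ := exists_eq_smul_monomialClass h2 z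
    exact ⟨monomial 0 a, natDegree_monomial_le a, (formClass_monomial t e 0 0 a).symm⟩
  | succ n ih =>
    obtain ⟨a, ha⟩ := exists_eq_smul_extensionπ_comp_monomialClass h2
      ((Ext.mk₀ (extensionπ k e (1 : k) 0)).comp z (zero_add _))
    obtain ⟨y, hy⟩ := exists_eq_extensionClass_comp_of_extensionπ_comp_eq_zero (u := (1 : k))
      (v := 0) (z := z - a • monomialClass t (n + 1) (n + 1) e) e
      (by rw [sub_eq_add_neg, Ext.comp_add, Ext.comp_neg, Ext.comp_smul, ha, add_neg_cancel])
    obtain ⟨q, hq, rfl⟩ := ih y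
    refine ⟨(C 1 + C 0 * X) * q + monomial (n + 1) a, ?_, ?_⟩
    · refine natDegree_add_le_of_degree_le ?_ (natDegree_monomial_le a)
      simpa using hq.trans n.le_succ
    · rw [map_add, formClass_mul t e 1 0 hq, formClass_monomial, ← hy, sub_add_cancel]

open Polynomial in
theorem exists_eq_linear_mul [IsAlgClosed k] {p : k[X]} {n : ℕ} (hp : p.natDegree ≤ n + 1) :
    ∃ (c d : k) (q : k[X]), (c, d) ≠ (0, 0) ∧ q.natDegree ≤ n ∧ p = (C c + C d * X) * q := by
  rcases hp.lt_or_eq with hlt | heq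
  · exact ⟨1, 0, p, by simp, Nat.le_of_lt_succ hlt, by simp⟩
  · obtain ⟨r, hr⟩ := IsAlgClosed.exists_root p fun h => by
      simp [natDegree_eq_of_degree_eq_some h] at heq
    refine ⟨-r, 1, p /ₘ (X - C r), by simp, ?_, ?_⟩
    · rw [natDegree_divByMonic p (monic_X_sub_C r), natDegree_X_sub_C, heq, Nat.add_sub_cancel]
    · rw [C_neg, C_1, one_mul, neg_add_eq_sub, mul_divByMonic_eq_iff_isRoot.2 hr]

theorem exists_eq_extensionClass_comp [IsAlgClosed k] (h2 : (2 : k) ≠ 0) {t e : ℤˣ} {n : ℕ}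
    (z : Ext (simpleMod k e) (simpleMod k t) (n + 1)) :
    ∃ (c d : k) (y : Ext (simpleMod k (-e)) (simpleMod k t) n), (c, d) ≠ (0, 0) ∧
      z = (extensionClass k e c d).comp y (add_comm 1 n) := by
  obtain ⟨p, hp, rfl⟩ := exists_eq_formClass h2 z
  obtain ⟨c, d, q, hcd, hq, rfl⟩ := exists_eq_linear_mul hp
  exact ⟨c, d, formClass t n (-e) q, hcd, formClass_mul t e c d hq⟩

end Forms

end Taft

namespace Induced

variable {k A V M : Type u} [Field k] [Ring A] [Algebra k A] (H : Subalgebra k A) [AddCommGroup V]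
  [Module k V] [Module H V] [AddCommGroup M] [Module k M] [Module A M] [IsScalarTower k A M]

/-- The canonical map from a module over the subalgebra to the induced module. -/
def mk : V →ₗ[k] Induced H V :=
  (Submodule.mkQ (Submodule.span A _)).restrictScalars k ∘ₗ TensorProduct.mk k A V 1

variable {H}

theorem coe_smul_mk (h : H) (v : V) : (h : A) • mk H v = mk H (h • v) := by
  refine (Submodule.Quotient.eq _).2 (Submodule.subset_span ⟨1, h, v, ?_⟩)
  rw [one_mul]
  exact congrArg (· - _) (congrArg (· ⊗ₜ[k] v) (mul_one (h : A)))

/-- The universal property of the induced module. -/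
def lift (f : V →ₗ[k] M) (hf : ∀ (h : H) (v : V), f (h • v) = (h : A) • f v) :
    Induced H V →ₗ[A] M :=
  Submodule.liftQ _
    (TensorProduct.AlgebraTensorModule.lift (LinearMap.toSpanSingleton A (V →ₗ[k] M) f)) <| by
      rw [Submodule.span_le]
      rintro _ ⟨a, h, v, rfl⟩
      simp [hf, mul_smul]

theorem lift_mk (f : V →ₗ[k] M) (hf : ∀ (h : H) (v : V), f (h • v) = (h : A) • f v) (v : V) :
    lift f hf (mk H v) = f v :=
  one_smul A (f v)

theorem hom_ext {F F' : Induced H V →ₗ[A] M} (h : ∀ v, F (mk H v) = F' (mk H v)) : F = F' := by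
  refine Submodule.linearMap_qext _ (TensorProduct.AlgebraTensorModule.ext fun a v => ?_)
  have hmk : Submodule.mkQ (Submodule.span A _) (a ⊗ₜ[k] v) = a • mk H v :=
    congrArg (Submodule.mkQ _) (congrArg (· ⊗ₜ[k] v) (mul_one a).symm)
  have hF (F : Induced H V →ₗ[A] M) :
      F (Submodule.mkQ _ (a ⊗ₜ[k] v)) = a • F (mk H v) :=
    (congrArg F hmk).trans (F.map_smul a _)
  exact (hF F).trans ((congrArg (a • ·) (h v)).trans (hF F').symm)

end Induced

namespace Induced

variable {k A M : Type u} [Field k] [Ring A] [HopfAlgebra k A] (H : Subalgebra k A)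
  [AddCommGroup M] [Module k M] [Module A M] [IsScalarTower k A M]

/-- The canonical generator `1 ⊗ 1` of the module induced from the trivial module. -/
def unit : Induced H (TrivialMod H) :=
  mk H (1 : k)

variable {H}

theorem smul_unit {a : A} (ha : a ∈ H) :
    a • unit H = Bialgebra.counitAlgHom k A a • unit H :=
  (coe_smul_mk ⟨a, ha⟩ _).trans (map_smul (mk H) _ _)

theorem exists_hom_unit {m : M} (hm : ∀ a ∈ H, a • m = Bialgebra.counitAlgHom k A a • m) :
    ∃ F : Induced H (TrivialMod H) →ₗ[A] M, F (unit H) = m := by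
  let f : TrivialMod H →ₗ[k] M := LinearMap.toSpanSingleton k M m
  have hf (h : H) (r : k) :
      (Bialgebra.counitAlgHom k A h * r) • m = (h : A) • r • m := by
    rw [smul_algebra_smul_comm, hm h h.2, mul_comm, mul_smul]
  exact ⟨lift f hf, (lift_mk f hf _).trans (one_smul k m)⟩

theorem hom_ext_unit {F F' : Induced H (TrivialMod H) →ₗ[A] M} (h : F (unit H) = F' (unit H)) :
    F = F' := by
  refine hom_ext fun r => ?_
  obtain ⟨c, rfl⟩ : ∃ c : k, r = c • (show TrivialMod H from (1 : k)) :=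
    ⟨r, (mul_one (M := k) r).symm⟩
  have hc : mk H (c • _) = c • unit H := map_smul (mk H) c _
  rw [hc, F.map_smul_of_tower, F'.map_smul_of_tower, h]

end Induced

namespace DiagTensor

variable {k A L V W : Type u} [Field k] [Ring A] [HopfAlgebra k A] [AddCommGroup L] [Module k L]
  [Module A L] [IsScalarTower k A L] [AddCommGroup V] [Module k V] [Module A V]
  [IsScalarTower k A V] [AddCommGroup W] [Module k W] [Module A W] [IsScalarTower k A W]

/-- The identity map from the tensor product to the module carried by it. -/
def of : L ⊗[k] V ≃ₗ[k] DiagTensor k A L V := LinearEquiv.refl k (L ⊗[k] V)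

theorem smul_of (a : A) (t : L ⊗[k] V) :
    a • of (A := A) t = of (diagAction L V a t) := rfl

instance : IsScalarTower k A (DiagTensor k A L V) where
  smul_assoc c a t := by
    obtain ⟨t, rfl⟩ := of.surjective t
    rw [smul_of, smul_of, map_smul, LinearMap.smul_apply, map_smul]

theorem lTensor_diagAction (F : V →ₗ[A] W) (a : A) (t : L ⊗[k] V) :
    (F.restrictScalars k).lTensor L (diagAction L V a t) =
      diagAction L W a ((F.restrictScalars k).lTensor L t) := by
  simp only [diagAction, AlgHom.comp_apply]
  generalize Bialgebra.comulAlgHom k A a = b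
  induction b using TensorProduct.induction_on with
  | zero => simp
  | add b b' h h' => simp only [map_add, LinearMap.add_apply, h, h']
  | tmul b b' =>
    induction t using TensorProduct.induction_on with
    | zero => simp
    | add t t' h h' => simp only [map_add, h, h']
    | tmul l v => simp [Module.endTensorEndAlgHom_apply]

/-- The functoriality of the tensor product in its second factor, for isomorphisms. -/
def congrRight (F : V ≃ₗ[A] W) : DiagTensor k A L V ≃ₗ[A] DiagTensor k A L W :=
  { (F.restrictScalars k).lTensor L with
    map_smul' := lTensor_diagAction F.toLinearMap }

end DiagTensor

namespace Taft

variable {k : Type u} [Field k]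

section LinearAlgebra

variable {V : Type*} [AddCommGroup V] [Module k V]

theorem exists_eq_smul_and_eq_smul {c d : k}
    (hcd : (c, d) ≠ (0, 0)) {u v : V} (h : d • u = c • v) : ∃ y : V, u = c • y ∧ v = d • y := by
  rcases eq_or_ne c 0 with rfl | hc
  · have hd : d ≠ 0 := fun hd => hcd (by rw [hd])
    refine ⟨d⁻¹ • v, ?_, (smul_inv_smul₀ hd v).symm⟩
    simpa [hd] using h
  · refine ⟨c⁻¹ • u, (smul_inv_smul₀ hc u).symm, ?_⟩
    rw [smul_comm, h, inv_smul_smul₀ hc]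

theorem eq_of_smul_eq_of_smul_eq {c d : k}
    (hcd : (c, d) ≠ (0, 0)) {u v : V} (hc : c • u = c • v) (hd : d • u = d • v) : u = v := by
  rcases eq_or_ne c 0 with rfl | hc0
  · exact smul_right_injective V (fun hd0 => hcd (by rw [hd0])) hd
  · exact smul_right_injective V hc0 hc

theorem smul_eq_smul_of_mem_adjoin {A : Type*} [Ring A] [Algebra k A] (χ : A →ₐ[k] k) {N : Type*}
    [AddCommGroup N] [Module k N] [Module A N] [IsScalarTower k A N] {s : Set A} {m : N}
    (hs : ∀ a ∈ s, a • m = χ a • m) {a : A} (ha : a ∈ Algebra.adjoin k s) : a • m = χ a • m := by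
  induction ha using Algebra.adjoin_induction with
  | mem a ha => exact hs a ha
  | algebraMap c => rw [algebraMap_smul, AlgHom.commutes, Algebra.algebraMap_self_apply]
  | add a b _ _ ha hb => rw [add_smul, ha, hb, map_add, add_smul]
  | mul a b _ _ ha hb => rw [mul_smul, hb, smul_algebra_smul_comm, ha, map_mul, mul_comm, mul_smul]

end LinearAlgebra

section LineExtensions

variable {M : Type*} [AddCommGroup M] [Module k M] [Module (Double k) M]
  [IsScalarTower k (Double k) M]

theorem exists_extension_hom {e : ℤˣ} {c d : k} (hcd : (c, d) ≠ (0, 0)) {w : M}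
    (hg : gen k .g • w = e • w) (hG : gen k .G • w = e • w)
    (hw : d • gen k .x • w = c • gen k .X • w) :
    ∃ F : Supermod (extension k e c d) →ₗ[Double k] M, F (Supermod.of _ (1, 0)) = w := by
  obtain ⟨y, hx, hX⟩ := exists_eq_smul_and_eq_smul hcd hw
  have hxx : c • gen k .x • y = 0 := by rw [smul_comm, ← hx, x_smul_x_smul]
  have hXX : d • gen k .X • y = 0 := by rw [smul_comm, ← hX, X_smul_X_smul]
  have hgG : gen k .g • gen k .G • w = w := by
    rw [hG, smul_comm, hg, ← mul_smul, Int.units_mul_self, one_smul]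
  have hxX : d • gen k .x • y = -(c • gen k .X • y) := by
    rw [smul_comm, ← hX, smul_comm c, ← hx, X_smul_x_smul, hgG, sub_self, zero_sub, neg_neg]
  have hy : gen k .x • y = 0 ∧ gen k .X • y = 0 := by
    rcases eq_or_ne c 0 with rfl | hc
    · have hd : d ≠ 0 := fun hd => hcd (by rw [hd])
      simp_all
    · simp_all
  have hgy : gen k .g • y = -e • y :=
    eq_of_smul_eq_of_smul_eq hcd
      (by rw [smul_comm, ← hx, smul_comm c, ← hx, g_smul_x_smul, hg, smul_comm, Units.neg_smul])
      (by rw [smul_comm, ← hX, smul_comm d, ← hX, g_smul_X_smul, hg, smul_comm, Units.neg_smul])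
  have hGy : gen k .G • y = -e • y :=
    eq_of_smul_eq_of_smul_eq hcd
      (by rw [smul_comm, ← hx, smul_comm c, ← hx, G_smul_x_smul, hG, smul_comm, Units.neg_smul])
      (by rw [smul_comm, ← hX, smul_comm d, ← hX, G_smul_X_smul, hG, smul_comm, Units.neg_smul])
  let f : k × k →ₗ[k] M :=
    (LinearMap.toSpanSingleton k M w).coprod (LinearMap.toSpanSingleton k M y)
  have hf (a : Gen) (m : k × k) : f ((extension k e c d).op a m) = gen k a • f m := by
    cases a <;>
      simp [f, ExteriorAction.op, smul_comm _ m.1, smul_comm _ m.2, hx, hX, hy, hg, hG, hgy, hGy,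
        mul_smul]
  exact ⟨Supermod.desc f hf, by simp [f]⟩

theorem extension_hom_ext {e : ℤˣ} {c d : k} (hcd : (c, d) ≠ (0, 0))
    {F F' : Supermod (extension k e c d) →ₗ[Double k] M}
    (h : F (Supermod.of _ (1, 0)) = F' (Supermod.of _ (1, 0))) : F = F' := by
  have hx : c • Supermod.of (extension k e c d) (0, 1) = gen k .x • Supermod.of _ (1, 0) := by
    simp [Supermod.gen_smul_of, ExteriorAction.op, ← map_smul]
  have hX : d • Supermod.of (extension k e c d) (0, 1) = gen k .X • Supermod.of _ (1, 0) := by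
    simp [Supermod.gen_smul_of, ExteriorAction.op, ← map_smul]
  have h' : F (Supermod.of _ (0, 1)) = F' (Supermod.of _ (0, 1)) := by
    refine eq_of_smul_eq_of_smul_eq hcd ?_ ?_
    · rw [← F.map_smul_of_tower, ← F'.map_smul_of_tower, hx, map_smul, map_smul, h]
    · rw [← F.map_smul_of_tower, ← F'.map_smul_of_tower, hX, map_smul, map_smul, h]
  have hcomp : F.restrictScalars k ∘ₗ (Supermod.of _).toLinearMap =
      F'.restrictScalars k ∘ₗ (Supermod.of _).toLinearMap :=
    LinearMap.prod_ext (LinearMap.ext_ring h) (LinearMap.ext_ring h')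
  ext m
  exact LinearMap.congr_fun hcomp ((Supermod.of _).symm m)

theorem counit_gen (a : Gen) : Coalgebra.counit (R := k) (gen k a) = counitGen (k := k) a := by
  rw [counit_apply, counitHom, lift_gen]

theorem counit_smul_of_mem_subalgH {c d : k} {m : M} (hg : gen k .g • m = m)
    (hG : gen k .G • m = m) (hx : (c • gen k .x + d • gen k .X) • m = 0) {a : Double k}
    (ha : a ∈ subalgH k c d) : a • m = Bialgebra.counitAlgHom k (Double k) a • m := by
  refine smul_eq_smul_of_mem_adjoin _ ?_ ha
  rintro _ (rfl | rfl | rfl)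
  · simp [hg, counit_gen, counitGen]
  · simp [hG, counit_gen, counitGen]
  · simp [hx, counit_gen, counitGen]

theorem subalgH_smul_of {c d : k} {a : Double k} (ha : a ∈ subalgH k d (-c)) :
    a • Supermod.of (extension k 1 c d) (1, 0) =
      Bialgebra.counitAlgHom k (Double k) a • Supermod.of (extension k 1 c d) (1, 0) := by
  refine counit_smul_of_mem_subalgH ?_ ?_ ?_ ha
  · simp [Supermod.gen_smul_of, ExteriorAction.op]
  · simp [Supermod.gen_smul_of, ExteriorAction.op]
  · simp [add_smul, Supermod.gen_smul_of, ExteriorAction.op, ← map_smul, mul_comm]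

theorem subalgH_ne_top {c d : k} (hcd : (c, d) ≠ (0, 0)) : subalgH k d (-c) ≠ ⊤ := by
  intro htop
  have h (a : Gen) := subalgH_smul_of (c := c) (d := d) (a := gen k a) (htop ▸ Algebra.mem_top)
  have hc : c = 0 := by
    simpa [Supermod.gen_smul_of, ExteriorAction.op, counit_gen, counitGen] using h .x
  have hd : d = 0 := by
    simpa [Supermod.gen_smul_of, ExteriorAction.op, counit_gen, counitGen] using h .X
  exact hcd (by rw [hc, hd])

theorem nonempty_equiv_induced {c d : k} (hcd : (c, d) ≠ (0, 0)) :
    Nonempty (Supermod (extension k 1 c d) ≃ₗ[Double k]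
      Induced (subalgH k d (-c)) (TrivialMod (subalgH k d (-c)))) := by
  have smul_unit {a : Double k} (ha : a ∈ subalgH k d (-c)) := Induced.smul_unit ha
  have hg : gen k .g • Induced.unit (subalgH k d (-c)) = (1 : ℤˣ) • Induced.unit _ :=
    (smul_unit (Algebra.subset_adjoin (by simp))).trans (by simp [counit_gen, counitGen])
  have hG : gen k .G • Induced.unit (subalgH k d (-c)) = (1 : ℤˣ) • Induced.unit _ :=
    (smul_unit (Algebra.subset_adjoin (by simp))).trans (by simp [counit_gen, counitGen])
  have hx : d • gen k .x • Induced.unit (subalgH k d (-c)) = c • gen k .X • Induced.unit _ := by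
    have h := smul_unit (a := d • gen k .x + (-c) • gen k .X) (Algebra.subset_adjoin (by simp))
    rw [← sub_eq_zero]
    simpa [add_smul, counit_gen, counitGen, sub_eq_add_neg] using h
  obtain ⟨F, hF⟩ := exists_extension_hom hcd hg hG hx
  obtain ⟨F', hF'⟩ := Induced.exists_hom_unit fun a => subalgH_smul_of (c := c) (d := d) (a := a)
  exact ⟨.ofLinearMap F F'
    (Induced.hom_ext_unit (by rw [LinearMap.comp_apply, hF', hF, LinearMap.id_apply]))
    (extension_hom_ext hcd (by rw [LinearMap.comp_apply, hF, hF', LinearMap.id_apply]))⟩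

end LineExtensions

section DiagonalAction

variable {L V : Type u} [AddCommGroup L] [Module k L] [Module (Double k) L]
  [IsScalarTower k (Double k) L] [AddCommGroup V] [Module k V] [Module (Double k) V]
  [IsScalarTower k (Double k) V]

theorem diagAction_x_tmul (l : L) (v : V) :
    diagAction L V (gen k .x) (l ⊗ₜ[k] v) =
      l ⊗ₜ (gen k .x • v) + (gen k .x • l) ⊗ₜ (gen k .g • v) := by
  simp [diagAction, comul_apply, comulHom, comulGen, Module.endTensorEndAlgHom_apply]

theorem diagAction_X_tmul (l : L) (v : V) :
    diagAction L V (gen k .X) (l ⊗ₜ[k] v) =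
      l ⊗ₜ (gen k .X • v) + (gen k .X • l) ⊗ₜ (gen k .G • v) := by
  simp [diagAction, comul_apply, comulHom, comulGen, Module.endTensorEndAlgHom_apply]

theorem diagAction_g_tmul (l : L) (v : V) :
    diagAction L V (gen k .g) (l ⊗ₜ[k] v) = (gen k .g • l) ⊗ₜ (gen k .g • v) := by
  simp [diagAction, comul_apply, comulHom, comulGen, Module.endTensorEndAlgHom_apply]

theorem diagAction_G_tmul (l : L) (v : V) :
    diagAction L V (gen k .G) (l ⊗ₜ[k] v) = (gen k .G • l) ⊗ₜ (gen k .G • v) := by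
  simp [diagAction, comul_apply, comulHom, comulGen, Module.endTensorEndAlgHom_apply]

theorem nonempty_extension_equiv_diagTensor (e : ℤˣ) (c d : k) :
    Nonempty (Supermod (extension k e c d) ≃ₗ[Double k]
      DiagTensor k (Double k) (Supermod (isotypic k e k)) (Supermod (extension k 1 c d))) := by
  let F : (k × k) ≃ₗ[k] Supermod (isotypic k e k) ⊗[k] Supermod (extension k 1 c d) :=
    (TensorProduct.lid k (k × k)).symm.trans
      (TensorProduct.congr (Supermod.of (isotypic k e k)) (Supermod.of (extension k 1 c d)))
  have hF (m : k × k) :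
      F m = Supermod.of (isotypic k e k) 1 ⊗ₜ[k] Supermod.of (extension k 1 c d) m := rfl
  have hgen (a : Gen) (m : k × k) :
      F ((extension k e c d).op a m) = diagAction _ _ (gen k a) (F m) := by
    have hneg (v : Supermod (extension k 1 c d)) :
        (-Supermod.of (isotypic k e k) 1) ⊗ₜ[k] v = Supermod.of (isotypic k e k) 1 ⊗ₜ[k] (-v) := by
      rw [TensorProduct.neg_tmul, TensorProduct.tmul_neg]
    rw [hF, hF]
    rcases Int.units_eq_one_or e with rfl | rfl <;> cases a <;>
      simp [diagAction_x_tmul, diagAction_X_tmul, diagAction_g_tmul, diagAction_G_tmul,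
        Supermod.gen_smul_of, ExteriorAction.op, hneg, ← map_neg (Supermod.of (extension k 1 c d))]
  let F' := Supermod.desc (ρ := extension k e c d) (F.trans DiagTensor.of).toLinearMap
    fun a m => (congrArg DiagTensor.of (hgen a m)).trans (DiagTensor.smul_of _ _).symm
  exact ⟨.ofBijective F' (F.trans DiagTensor.of).bijective⟩

end DiagonalAction

section InducedType

open Abelian

theorem exists_extension_equiv_diagTensor_induced (e : ℤˣ) {c d : k} (hcd : (c, d) ≠ (0, 0)) :
    ∃ H ∈ familyH k, H ≠ ⊤ ∧
    ∃ (L : Type u) (_ : AddCommGroup L) (_ : Module k L) (_ : Module (Double k) L)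
      (_ : IsScalarTower k (Double k) L), Module.Finite k L ∧
      Nonempty ((extension k e c d).mod ≃ₗ[Double k]
        DiagTensor k (Double k) L (Induced H (TrivialMod H))) := by
  have hdc : (d, -c) ≠ (0, 0) := fun h => hcd (by simp_all)
  obtain ⟨F⟩ := nonempty_equiv_induced hcd
  obtain ⟨F'⟩ := nonempty_extension_equiv_diagTensor e c d
  exact ⟨subalgH k d (-c), ⟨d, -c, hdc, rfl⟩, subalgH_ne_top hcd,
    Supermod (isotypic k e k), _, _, _, inferInstance,
    .equiv (Supermod.of (isotypic k e k)), ⟨F'.trans (DiagTensor.congrRight F)⟩⟩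

theorem isOfInducedType_extensionClass {e : ℤˣ} {c d : k} (h : extensionClass k e c d ≠ 0) :
    IsOfInducedType (familyH k) (extensionClass k e c d) := by
  have hcd : (c, d) ≠ (0, 0) := fun hcd => h (by
    rw [extensionClass_eq_smul_add_smul, (Prod.mk.inj hcd).1, (Prod.mk.inj hcd).2, zero_smul,
      zero_smul, add_zero])
  exact ⟨.single _ _ _ (extensionSeq_shortExact k e c d), rfl,
    exists_extension_equiv_diagTensor_induced e hcd⟩

theorem isOfInducedType_one [IsAlgClosed k] (h2 : (2 : k) ≠ 0) {e t : ℤˣ}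
    {z : Ext (simpleMod k e) (simpleMod k t) 1} (hz : z ≠ 0) : IsOfInducedType (familyH k) z := by
  obtain ⟨c, d, y, -, rfl⟩ := exists_eq_extensionClass_comp h2 z
  obtain ⟨F, rfl⟩ := (Ext.mk₀_bijective _ _).surjective y
  have het : -e = t := by
    by_contra het
    rw [eq_zero_of_isotypic_hom h2 het F, Ext.mk₀_zero, Ext.comp_zero] at hz
    exact hz rfl
  subst het
  obtain ⟨φ, rfl⟩ := exists_eq_isotypicMap F
  rw [extensionClass_comp_isotypicMap] at hz ⊢
  exact isOfInducedType_extensionClass hz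

theorem isOfInducedType [IsAlgClosed k] (h2 : (2 : k) ≠ 0) {e t : ℤˣ} {n : ℕ} (hn : 1 ≤ n)
    {z : Ext (simpleMod k e) (simpleMod k t) n} (hz : z ≠ 0) :
    IsOfInducedType (familyH k) z := by
  induction n, hn using Nat.le_induction generalizing e with
  | base => exact isOfInducedType_one h2 hz
  | succ n _ ih =>
    obtain ⟨c, d, y, hcd, rfl⟩ := exists_eq_extensionClass_comp h2 z
    obtain ⟨T, rfl, hT⟩ := ih (z := y) fun hy => hz (by rw [hy, Ext.comp_zero])
    exact ⟨.splice _ _ _ (extensionSeq_shortExact k e c d) T, rfl,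
      exists_extension_equiv_diagTensor_induced e hcd, hT⟩

end InducedType

section OneDimensionalModules

theorem charMod_eq_simpleMod {e : ℤˣ} {χ : Double k →ₐ[k] k}
    (h : ∀ a, (isotypic k e k).op a = χ (gen k a) • 1) :
    ModuleCat.of (Double k) (CharMod χ) = simpleMod k e := by
  have hχ : lift (k := k) _ (isotypic k e k).op_satisfiesRel = (Algebra.ofId k _).comp χ :=
    algHom_ext fun a => by
      rw [lift_gen, h, AlgHom.comp_apply, Algebra.ofId_apply, Algebra.algebraMap_eq_smul_one]
  refine congrArg (fun m : Module (Double k) k => @ModuleCat.of (Double k) _ k _ m)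
    (Module.ext' _ _ fun a v => ?_)
  exact (LinearMap.congr_fun (DFunLike.congr_fun hχ a) v).symm

theorem plusMod_eq : plusMod k = simpleMod k 1 :=
  charMod_eq_simpleMod fun a => by
    rw [Bialgebra.counitAlgHom_apply, counit_gen]
    cases a <;> simp [counitGen, ExteriorAction.op]

theorem minusMod_eq : minusMod k = simpleMod k (-1) :=
  charMod_eq_simpleMod fun a => by
    rw [lift_gen]
    cases a <;> ext <;> simp [minusGen, ExteriorAction.op]

end OneDimensionalModules

end Taft

end

theorem mainTheorem5 (k : Type u) [Field k] [IsAlgClosed k] (h2 : (2 : k) ≠ 0)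
    (n : ℕ) (hn : 1 ≤ n) :
    (∀ ξ : Abelian.Ext.{u} (Taft.plusMod k) (Taft.plusMod k) n, ξ ≠ 0 →
      IsOfInducedType (Taft.familyH k) ξ) ∧
    (∀ ξ : Abelian.Ext.{u} (Taft.plusMod k) (Taft.minusMod k) n, ξ ≠ 0 →
      IsOfInducedType (Taft.familyH k) ξ) ∧
    (∀ ξ : Abelian.Ext.{u} (Taft.minusMod k) (Taft.plusMod k) n, ξ ≠ 0 →
      IsOfInducedType (Taft.familyH k) ξ) ∧
    (∀ ξ : Abelian.Ext.{u} (Taft.minusMod k) (Taft.minusMod k) n, ξ ≠ 0 →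
      IsOfInducedType (Taft.familyH k) ξ) := by
  rw [Taft.plusMod_eq, Taft.minusMod_eq]
  exact ⟨fun _ => Taft.isOfInducedType h2 hn, fun _ => Taft.isOfInducedType h2 hn,
    fun _ => Taft.isOfInducedType h2 hn, fun _ => Taft.isOfInducedType h2 hn⟩
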